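/- For positive integers $K\le P$ and $n\ge 3$, let $K_1(\theta),\dots,K_n(\theta)$, $\theta=(K,P)$, be i.i.d. random sets, each uniformly distributed over the $K$-element subsets of a fixed set of $P$ keys. The random key graph $\mathbb{K}(n;\theta)$ is the graph on $\{1,\dots,n\}$ in which distinct nodes $i,j$ are adjacent if and only if $K_i(\theta)\cap K_j(\theta)\neq\emptyset$. Let $T(n,\theta)$ be the event that $\mathbb{K}(n;\theta)$ contains at least one triangle, and put $$q(\theta)=\begin{cases}0 & \text{if } P<2K,\\ \binom{P-K}{K}\big/\binom{P}{K} & \text{if } 2K\le P,\end{cases}\qquad \tau(\theta)=\frac{K^3}{P^2}+\left(\frac{K^2}{P}\right)^3 .$$ **Theorem.** Let $\theta_n=(K_n,P_n)$ be a sequence of pairs of positive integers with $K_n\le P_n$ for $n=2,3,\dots$, and suppose that $\lim_{n\to\infty}q(\theta_n)=1$. Then $$\lim_{n\to\infty}\mathbb{P}[T(n,\theta_n)]=\begin{cases}0 & \text{if }\lim_{n\to\infty}n^3\tau(\theta_n)=0,\\ 1 & \text{if }\lim_{n\to\infty}n^3\tau(\theta_n)=\infty.\end{cases}$$ -/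

import Mathlib

open MeasureTheory ProbabilityTheory Filter Topology

namespace RandomKeyGraph

/-- A scaling: integers `1 ≤ K n ≤ P n` for `n = 2, 3, …`. -/
structure IsScaling (K P : ℕ → ℕ) : Prop where
  pos : ∀ n, 2 ≤ n → 0 < K n
  le : ∀ n, 2 ≤ n → K n ≤ P n

/-- The probability that two independent uniform key rings of size `K` out of a pool of size `P`
are disjoint: `0` if `P < 2K`, and `C(P-K, K) / C(P, K)` if `2K ≤ P`. -/
noncomputable def q (K P : ℕ) : ℝ :=
  if P < 2 * K then 0 else ((P - K).choose K : ℝ) / (P.choose K : ℝ)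

/-- `τ(K, P) = K³ / P² + (K² / P)³`. -/
noncomputable def tau (K P : ℕ) : ℝ :=
  (K : ℝ) ^ 3 / (P : ℝ) ^ 2 + ((K : ℝ) ^ 2 / (P : ℝ)) ^ 3

/-- The family `R 0, …, R (n-1)` of random sets of keys from the pool `Fin P` consists of i.i.d.
random variables, each uniformly distributed over the subsets of the pool with exactly `K`
elements. The finite type of sets of keys carries the discrete σ-algebra. -/
structure IsKeyRings {Ω : Type*} [MeasurableSpace Ω] (μ : Measure Ω) {n P : ℕ} (K : ℕ)
    (R : Fin n → Ω → Finset (Fin P)) : Prop where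
  measurable : ∀ i, Measurable[_, (⊤ : MeasurableSpace (Finset (Fin P)))] (R i)
  indep : iIndepFun (m := fun _ => (⊤ : MeasurableSpace (Finset (Fin P)))) R μ
  uniform : ∀ i, ∀ S : Finset (Fin P), S.card = K →
    μ.real {ω | R i ω = S} = ((P.choose K : ℝ))⁻¹

/-- The key graph on `n` nodes with key rings `r`: distinct nodes are adjacent when their key
rings share at least one key. -/
def keyGraph {n P : ℕ} (r : Fin n → Finset (Fin P)) : SimpleGraph (Fin n) where
  Adj i j := i ≠ j ∧ (r i ∩ r j).Nonempty
  symm := ⟨fun i j h => ⟨h.1.symm, by rw [Finset.inter_comm]; exact h.2⟩⟩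
  loopless := ⟨fun _ h => h.1 rfl⟩

instance {n P : ℕ} (r : Fin n → Finset (Fin P)) : DecidableRel (keyGraph r).Adj :=
  fun i j => inferInstanceAs (Decidable (i ≠ j ∧ (r i ∩ r j).Nonempty))

/-- The number of (unlabelled) triangles in the key graph. -/
def numTriangles {n P : ℕ} (r : Fin n → Finset (Fin P)) : ℕ :=
  ((keyGraph r).cliqueFinset 3).card

/-- The event that the random key graph with key rings `R` contains at least one triangle. -/
def triangleEvent {Ω : Type*} {n P : ℕ} (R : Fin n → Ω → Finset (Fin P)) : Set Ω :=
  {ω | 0 < numTriangles (fun i => R i ω)}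

end RandomKeyGraph

/-! Write p = K²/P and ρ = K/P, so that τ = Kρ² + p³. Three rings meet pairwise either through one
key common to all of them, which has probability of order Pρ³ = Kρ², or through different keys, of
order p³. Hence the probability β of a triangle on three given nodes satisfies β ≤ τ always and β ≥
τ/32 when p ≤ 1/16; both bounds hold even conditionally on one ring (`triangleProbGiven_le_tau`,
`le_triangleProbGiven`).

The zero law is the union bound over triples. The one law is Chebyshev's inequality for the number
of triangles with one vertex in each of three disjoint classes of about n/3 nodes. Pairs of such
triangles that share no node are independent; those sharing a vertex, an edge or everything
contribute at most τ², 4τ²/p and τ each. Divided by the squared mean, of order n⁶τ², the variance is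
bounded by terms of order 1/n, 1/(n²p) and 1/(n³τ).

The hypothesis q → 1 gives p → 0 because q ≤ exp(-p) (`q_le_exp`), and n²p → ∞ follows from n³τ → ∞
because τ² ≤ 4p³ when p ≤ 1 (`tau_sq_le`). -/

namespace RandomKeyGraph

/-! ### Expectations over key rings as finite weighted sums -/

section basics

variable {P : ℕ}

/-- The probability weight that the uniform law on `K`-element key rings gives to `S`. -/
noncomputable def ringWeight (K : ℕ) (S : Finset (Fin P)) : ℝ :=
  if S.card = K then (P.choose K : ℝ)⁻¹ else 0

/-- The expectation of `f` at a uniform `K`-element key ring. -/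
noncomputable def ringAvg (K : ℕ) (f : Finset (Fin P) → ℝ) : ℝ :=
  ∑ S, ringWeight K S * f S

/-- The expectation of `G` at a family of independent uniform `K`-element key rings. -/
noncomputable def familyAvg {ι : Type*} [Fintype ι] [DecidableEq ι] (K : ℕ)
    (G : (ι → Finset (Fin P)) → ℝ) : ℝ :=
  ∑ r, (∏ i, ringWeight K (r i)) * G r

lemma ringWeight_nonneg (K : ℕ) (S : Finset (Fin P)) : 0 ≤ ringWeight K S := by
  unfold ringWeight
  split_ifs <;> positivity

lemma ringAvg_eq_sum_powersetCard (K : ℕ) (f : Finset (Fin P) → ℝ) :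
    ringAvg K f = (P.choose K : ℝ)⁻¹ * ∑ S ∈ Finset.univ.powersetCard K, f S := by
  have h : (Finset.univ.powersetCard K : Finset (Finset (Fin P)))
      = Finset.univ.filter (fun S => S.card = K) := by
    ext S; simp [Finset.mem_powersetCard]
  rw [h, Finset.sum_filter, Finset.mul_sum, ringAvg]
  refine Finset.sum_congr rfl fun S _ => ?_
  unfold ringWeight
  split_ifs <;> simp

lemma sum_ringWeight {K : ℕ} (hK : K ≤ P) : ∑ S : Finset (Fin P), ringWeight K S = 1 := by
  have h := ringAvg_eq_sum_powersetCard (P := P) K (fun _ => 1)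
  have hc : (P.choose K : ℝ) ≠ 0 := by exact_mod_cast (Nat.choose_pos hK).ne'
  simpa [ringAvg, hc] using h

section ringAvg

variable {K : ℕ}

lemma ringAvg_const (hK : K ≤ P) (c : ℝ) : ringAvg K (fun _ : Finset (Fin P) => c) = c := by
  simp [ringAvg, ← Finset.sum_mul, sum_ringWeight hK]

lemma ringAvg_add (f g : Finset (Fin P) → ℝ) :
    ringAvg K (fun S => f S + g S) = ringAvg K f + ringAvg K g := by
  simp [ringAvg, mul_add, Finset.sum_add_distrib]

lemma ringAvg_sub (f g : Finset (Fin P) → ℝ) :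
    ringAvg K (fun S => f S - g S) = ringAvg K f - ringAvg K g := by
  simp [ringAvg, mul_sub, Finset.sum_sub_distrib]

lemma ringAvg_const_mul (c : ℝ) (f : Finset (Fin P) → ℝ) :
    ringAvg K (fun S => c * f S) = c * ringAvg K f := by
  simp only [ringAvg, Finset.mul_sum]
  exact Finset.sum_congr rfl fun S _ => by ring

lemma ringAvg_mul_const (c : ℝ) (f : Finset (Fin P) → ℝ) :
    ringAvg K (fun S => f S * c) = ringAvg K f * c := by
  simp only [ringAvg, Finset.sum_mul]
  exact Finset.sum_congr rfl fun S _ => by ring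

lemma ringAvg_sum {α : Type*} (s : Finset α) (f : α → Finset (Fin P) → ℝ) :
    ringAvg K (fun S => ∑ a ∈ s, f a S) = ∑ a ∈ s, ringAvg K (f a) := by
  simp only [ringAvg, Finset.mul_sum]
  exact Finset.sum_comm

lemma ringAvg_mono {f g : Finset (Fin P) → ℝ} (h : ∀ S, S.card = K → f S ≤ g S) :
    ringAvg K f ≤ ringAvg K g := by
  refine Finset.sum_le_sum fun S _ => ?_
  by_cases hS : S.card = K
  · exact mul_le_mul_of_nonneg_left (h S hS) (ringWeight_nonneg K S)
  · simp [ringWeight, hS]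

lemma ringAvg_nonneg {f : Finset (Fin P) → ℝ} (h : ∀ S, 0 ≤ f S) : 0 ≤ ringAvg K f :=
  Finset.sum_nonneg fun S _ => mul_nonneg (ringWeight_nonneg K S) (h S)

end ringAvg

section familyAvg

variable {ι : Type*} [Fintype ι] [DecidableEq ι] {K : ℕ}

lemma familyAvg_const (hK : K ≤ P) (c : ℝ) :
    familyAvg K (fun _ : ι → Finset (Fin P) => c) = c := by
  have h : ∑ r : ι → Finset (Fin P), ∏ i, ringWeight K (r i) = 1 := by
    rw [← Fintype.prod_sum]
    simp [sum_ringWeight hK]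
  simp [familyAvg, ← Finset.sum_mul, h]

lemma familyAvg_add (f g : (ι → Finset (Fin P)) → ℝ) :
    familyAvg K (fun S => f S + g S) = familyAvg K f + familyAvg K g := by
  simp [familyAvg, mul_add, Finset.sum_add_distrib]

lemma familyAvg_sub (f g : (ι → Finset (Fin P)) → ℝ) :
    familyAvg K (fun S => f S - g S) = familyAvg K f - familyAvg K g := by
  simp [familyAvg, mul_sub, Finset.sum_sub_distrib]

lemma familyAvg_const_mul (c : ℝ) (f : (ι → Finset (Fin P)) → ℝ) :
    familyAvg K (fun S => c * f S) = c * familyAvg K f := by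
  simp only [familyAvg, Finset.mul_sum]
  exact Finset.sum_congr rfl fun S _ => by ring

lemma familyAvg_sum {α : Type*} (s : Finset α) (f : α → (ι → Finset (Fin P)) → ℝ) :
    familyAvg K (fun S => ∑ a ∈ s, f a S) = ∑ a ∈ s, familyAvg K (f a) := by
  simp only [familyAvg, Finset.mul_sum]
  exact Finset.sum_comm

lemma familyAvg_mono {f g : (ι → Finset (Fin P)) → ℝ}
    (h : ∀ r, f r ≤ g r) : familyAvg K f ≤ familyAvg K g :=
  Finset.sum_le_sum fun r _ =>
    mul_le_mul_of_nonneg_left (h r) (Finset.prod_nonneg fun _ _ => ringWeight_nonneg K _)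

/-- Resampling one coordinate of an independent family does not change expectations. -/
lemma familyAvg_resample (hK : K ≤ P) (i : ι) (G : (ι → Finset (Fin P)) → ℝ) :
    familyAvg K G = familyAvg K (fun r => ringAvg K (fun S => G (Function.update r i S))) := by
  have hprod : ∀ (r : ι → Finset (Fin P)) (S : Finset (Fin P)),
      (∏ j, ringWeight K (Function.update r i S j)) * ringWeight K (r i)
        = (∏ j, ringWeight K (r j)) * ringWeight K S := by
    intro r S
    rw [← Finset.mul_prod_erase Finset.univ _ (Finset.mem_univ i),
      ← Finset.mul_prod_erase Finset.univ (fun j => ringWeight K (r j)) (Finset.mem_univ i)]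
    have : ∏ j ∈ Finset.univ.erase i, ringWeight K (Function.update r i S j)
        = ∏ j ∈ Finset.univ.erase i, ringWeight K (r j) :=
      Finset.prod_congr rfl fun j hj => by
        rw [Function.update_of_ne (Finset.ne_of_mem_erase hj)]
    rw [this, Function.update_self]
    ring
  have h1 : familyAvg K G = ∑ x : (ι → Finset (Fin P)) × Finset (Fin P),
      (∏ j, ringWeight K (x.1 j)) * ringWeight K x.2 * G x.1 := by
    rw [Fintype.sum_prod_type, familyAvg]
    refine Finset.sum_congr rfl fun r _ => ?_
    dsimp only
    rw [← Finset.sum_mul, ← Finset.mul_sum, sum_ringWeight hK, mul_one]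
  have h2 : familyAvg K (fun r => ringAvg K (fun S => G (Function.update r i S)))
      = ∑ x : (ι → Finset (Fin P)) × Finset (Fin P),
      (∏ j, ringWeight K (x.1 j)) * ringWeight K x.2 * G (Function.update x.1 i x.2) := by
    rw [Fintype.sum_prod_type, familyAvg]
    refine Finset.sum_congr rfl fun r _ => ?_
    rw [ringAvg, Finset.mul_sum]
    exact Finset.sum_congr rfl fun S _ => by ring
  rw [h1, h2]
  -- Exchanging coordinate `i` with the fresh independent ring is an involution that preserves the
  -- joint weight.
  let σ : (ι → Finset (Fin P)) × Finset (Fin P) → (ι → Finset (Fin P)) × Finset (Fin P) :=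
    fun x => (Function.update x.1 i x.2, x.1 i)
  have hσ : Function.Involutive σ := fun x => by simp [σ]
  refine (Fintype.sum_equiv hσ.toPerm _ _ fun x => ?_).symm
  simp only [Function.Involutive.coe_toPerm, σ]
  rw [hprod]

end familyAvg

/-! ### From the probability space to finite sums -/

section law

variable {Ω : Type*} [MeasurableSpace Ω] {μ : Measure Ω} [IsProbabilityMeasure μ] {n K : ℕ}
  {R : Fin n → Ω → Finset (Fin P)}

/-- Only the sets of size `K` have a prescribed probability, but these already add up to 1, so every
other set is null. -/
lemma IsKeyRings.real_eq_ringWeight (hR : IsKeyRings μ K R) (hK : K ≤ P) (i : Fin n)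
    (S : Finset (Fin P)) : μ.real {ω | R i ω = S} = ringWeight K S := by
  let _ : MeasurableSpace (Finset (Fin P)) := ⊤
  have hm : ∀ S, MeasurableSet {ω | R i ω = S} := fun S =>
    hR.measurable i (MeasurableSpace.measurableSet_top (s := {S}))
  have hsum : ∑ S, μ.real {ω | R i ω = S} = 1 := by
    rw [← measureReal_biUnion_finset (fun S _ T _ hST => Set.disjoint_left.2
      fun ω h1 h2 => hST (h1.symm.trans h2)) (fun S _ => hm S)]
    simp [Set.iUnion_ofPred]
  have hle : ∀ S ∈ Finset.univ, ringWeight K S ≤ μ.real {ω | R i ω = S} := by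
    intro S _
    unfold ringWeight
    split_ifs with h
    · exact (hR.uniform i S h).ge
    · exact measureReal_nonneg
  have := (Finset.sum_eq_sum_iff_of_le hle).1 (by rw [hsum, sum_ringWeight hK])
  exact (this S (Finset.mem_univ S)).symm

lemma IsKeyRings.real_eq_familyAvg (hR : IsKeyRings μ K R) (hK : K ≤ P)
    (A : Set (Fin n → Finset (Fin P))) :
    μ.real {ω | (fun i => R i ω) ∈ A} = familyAvg K (A.indicator 1) := by
  classical
  let _ : MeasurableSpace (Finset (Fin P)) := ⊤
  have hset : ∀ r : Fin n → Finset (Fin P), {ω | (fun i => R i ω) = r}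
      = ⋂ i ∈ (Finset.univ : Finset (Fin n)), R i ⁻¹' {r i} := by
    intro r; ext ω; simp [funext_iff]
  have hmi : ∀ i S, MeasurableSet (R i ⁻¹' {S}) := fun i S =>
    hR.measurable i (MeasurableSpace.measurableSet_top (s := {S}))
  have hm : ∀ r : Fin n → Finset (Fin P), MeasurableSet {ω | (fun i => R i ω) = r} := by
    intro r
    rw [hset]
    exact Finset.measurableSet_biInter _ fun i _ => hmi i _
  have hr : ∀ r : Fin n → Finset (Fin P),
      μ.real {ω | (fun i => R i ω) = r} = ∏ i, ringWeight K (r i) := by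
    intro r
    have h := hR.indep.measure_inter_preimage_eq_mul Finset.univ (sets := fun i => {r i})
      (fun i _ => MeasurableSpace.measurableSet_top)
    rw [hset, measureReal_def, h, ENNReal.toReal_prod]
    exact Finset.prod_congr rfl fun i _ => hR.real_eq_ringWeight hK i (r i)
  have hA : {ω | (fun i => R i ω) ∈ A}
      = ⋃ r ∈ Finset.univ.filter (fun r => r ∈ A), {ω | (fun i => R i ω) = r} := by
    ext ω; simp
  rw [hA, measureReal_biUnion_finset (fun S _ T _ hST => Set.disjoint_left.2
      fun ω h1 h2 => hST (h1.symm.trans h2)) (fun S _ => hm S), Finset.sum_filter, familyAvg]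
  refine Finset.sum_congr rfl fun r _ => ?_
  rw [hr]
  by_cases h : r ∈ A <;> simp [h]

end law

/-! ### Moments of intersection sizes -/

/-- The probability that a uniform `K`-element key ring contains `t` given keys. -/
noncomputable def containProb (K P t : ℕ) : ℝ := (K.choose t : ℝ) / (P.choose t : ℝ)

section moments

variable {K : ℕ}

/-- Double counting gives C(P-t, K-t) / C(P, K) = C(K, t) / C(P, t). The second form is also right
for t > K, where it vanishes. -/
lemma ringAvg_subset (hK : K ≤ P) (T : Finset (Fin P)) :
    ringAvg K (fun S => if T ⊆ S then (1 : ℝ) else 0) = containProb K P T.card := by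
  have hT : T.card ≤ P := by simpa using T.card_le_univ
  have hPT : (P.choose T.card : ℝ) ≠ 0 := by exact_mod_cast (Nat.choose_pos hT).ne'
  have hPK : (P.choose K : ℝ) ≠ 0 := by exact_mod_cast (Nat.choose_pos hK).ne'
  rw [ringAvg_eq_sum_powersetCard, ← Finset.sum_filter, Finset.sum_const, containProb]
  by_cases h : T.card ≤ K
  · rw [Finset.card_filter_powersetCard_subset T Finset.univ K (Finset.subset_univ _) h]
    have := Nat.choose_mul (n := P) h
    rw [Finset.card_univ, Fintype.card_fin, nsmul_eq_mul, mul_one]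
    field_simp
    exact_mod_cast (by rw [mul_comm, ← this, mul_comm] :
      (P - T.card).choose (K - T.card) * P.choose T.card = P.choose K * K.choose T.card)
  · have h0 : (Finset.univ.powersetCard K).filter (fun S => T ⊆ S) = ∅ := by
      ext S
      simp only [Finset.mem_filter, Finset.mem_powersetCard, Finset.notMem_empty, iff_false,
        not_and]
      rintro ⟨-, rfl⟩ hTS
      exact h (Finset.card_le_card hTS)
    rw [h0, Nat.choose_eq_zero_of_lt (not_le.1 h)]
    simp

lemma containProb_one : containProb K P 1 = (K : ℝ) / P := by simp [containProb]

lemma containProb_nonneg (t : ℕ) : 0 ≤ containProb K P t := by unfold containProb; positivity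

lemma containProb_two : containProb K P 2 = (K * (K - 1) : ℝ) / (P * (P - 1)) := by
  rw [containProb, Nat.cast_choose_two, Nat.cast_choose_two, div_div_div_cancel_right₀ two_ne_zero]

lemma containProb_two_le (hK0 : 0 < K) (hK : K ≤ P) : containProb K P 2 ≤ ((K : ℝ) / P) ^ 2 := by
  have h1 : (1 : ℝ) ≤ K := by exact_mod_cast hK0
  have h2 : (K : ℝ) ≤ P := by exact_mod_cast hK
  rw [containProb_two, div_pow]
  rcases eq_or_lt_of_le (h1.trans h2) with h | h
  -- Here `P = 1`: the denominator is zero, so the quotient is 0 by convention.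
  · rw [← h]; simp
  · rw [div_le_div_iff₀ (by nlinarith) (by positivity)]
    have : 0 ≤ (K : ℝ) * P * (P - K) := by
      have := sub_nonneg.2 h2
      positivity
    nlinarith

lemma le_containProb_two (hK0 : 2 ≤ K) (hK : K ≤ P) :
    ((K : ℝ) / P) ^ 2 / 2 ≤ containProb K P 2 := by
  have h1 : (2 : ℝ) ≤ K := by exact_mod_cast hK0
  have h2 : (K : ℝ) ≤ P := by exact_mod_cast hK
  rw [containProb_two, div_pow, div_div, div_le_div_iff₀ (by nlinarith) (by nlinarith)]
  have h3 : (0 : ℝ) ≤ P * (K - 2) + K := by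
    have := mul_nonneg (by linarith : (0 : ℝ) ≤ P) (sub_nonneg.2 h1); linarith
  have h4 : (0 : ℝ) ≤ K * P * (P * (K - 2) + K) := by positivity
  nlinarith

lemma containProb_three_le (hK0 : 0 < K) (hK : K ≤ P) :
    containProb K P 3 ≤ ((K : ℝ) / P) ^ 3 := by
  have hKP : (K : ℝ) ≤ P := by exact_mod_cast hK
  have hP0 : (0 : ℝ) < P := by exact_mod_cast hK0.trans_le hK
  have hK00 : (0 : ℝ) < K := by exact_mod_cast hK0
  rcases lt_or_ge K 3 with h | h
  · rw [containProb, Nat.choose_eq_zero_of_lt h]; simp; positivity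
  have hcast : ∀ n : ℕ, 3 ≤ n → (n.choose 3 : ℝ) = n * (n - 1) * (n - 2) / 6 := by
    intro n hn
    have h := Nat.choose_succ_right_eq n 2
    have h' : (n.choose 3 : ℝ) * 3 = n.choose 2 * (n - 2) := by
      have := congrArg (Nat.cast (R := ℝ)) h
      push_cast [Nat.cast_sub (show 2 ≤ n by omega)] at this
      linarith
    rw [Nat.cast_choose_two] at h'
    linarith
  have h3 : (3 : ℝ) ≤ K := by exact_mod_cast h
  rw [containProb, hcast K h, hcast P (h.trans hK), div_div_div_cancel_right₀ (by norm_num)]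
  have e1 : ((K : ℝ) - 1) / (P - 1) ≤ K / P := by
    rw [div_le_div_iff₀ (by linarith) hP0]; nlinarith
  have e2 : ((K : ℝ) - 2) / (P - 2) ≤ K / P := by
    rw [div_le_div_iff₀ (by linarith) hP0]; nlinarith
  have n1 : 0 ≤ ((K : ℝ) - 1) / (P - 1) := div_nonneg (by linarith) (by linarith)
  have n2 : 0 ≤ ((K : ℝ) - 2) / (P - 2) := div_nonneg (by linarith) (by linarith)
  calc (K : ℝ) * (K - 1) * (K - 2) / (P * (P - 1) * (P - 2))
      = K / P * ((K - 1) / (P - 1)) * ((K - 2) / (P - 2)) := by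
        rw [div_mul_div_comm, div_mul_div_comm]
    _ ≤ K / P * (K / P) * (K / P) := by gcongr
    _ = (K / P) ^ 3 := by ring

lemma cast_card_inter (A S : Finset (Fin P)) :
    ((A ∩ S).card : ℝ) = ∑ x ∈ A, if {x} ⊆ S then (1 : ℝ) else 0 := by
  simp [← Finset.filter_mem_eq_inter]

lemma ite_subset_mul_ite_subset (T U S : Finset (Fin P)) :
    (if T ⊆ S then (1 : ℝ) else 0) * (if U ⊆ S then (1 : ℝ) else 0)
      = if T ∪ U ⊆ S then (1 : ℝ) else 0 := by
  simp only [Finset.union_subset_iff]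
  split_ifs <;> simp_all

lemma ringAvg_card_inter (hK : K ≤ P) (A : Finset (Fin P)) :
    ringAvg K (fun S => ((A ∩ S).card : ℝ)) = A.card * (K / P) := by
  simp_rw [cast_card_inter]
  rw [ringAvg_sum]
  simp_rw [ringAvg_subset hK]
  simp [containProb_one]

lemma sum_sum_ite_eq (A : Finset (Fin P)) (c d : ℝ) :
    ∑ x ∈ A, ∑ y ∈ A, (if x = y then c else d) = A.card * c + A.card * (A.card - 1) * d := by
  have h : ∀ x ∈ A, ∑ y ∈ A, (if x = y then c else d) = c + (A.card - 1) * d := by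
    intro x hx
    have : ∀ y ∈ A, (if x = y then c else d) = d + if x = y then c - d else 0 := by
      intro y _; split_ifs <;> ring
    rw [Finset.sum_congr rfl this, Finset.sum_add_distrib, Finset.sum_ite_eq, if_pos hx]
    simp; ring
  rw [Finset.sum_congr rfl h]
  simp; ring

lemma ringAvg_card_inter_sq (hK : K ≤ P) (A : Finset (Fin P)) :
    ringAvg K (fun S => ((A ∩ S).card : ℝ) ^ 2)
      = A.card * (K / P) + A.card * (A.card - 1) * containProb K P 2 := by
  simp_rw [sq, cast_card_inter, Finset.sum_mul_sum, ite_subset_mul_ite_subset]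
  rw [ringAvg_sum, ← sum_sum_ite_eq]
  refine Finset.sum_congr rfl fun x _ => ?_
  rw [ringAvg_sum]
  refine Finset.sum_congr rfl fun y _ => ?_
  rw [ringAvg_subset hK]
  split_ifs with h
  · simp [h, containProb_one]
  · congr 1; exact Finset.card_pair h

lemma ringAvg_card_inter_mul (hK : K ≤ P) {A B : Finset (Fin P)} (hAB : Disjoint A B) :
    ringAvg K (fun S => ((A ∩ S).card : ℝ) * (B ∩ S).card)
      = A.card * B.card * containProb K P 2 := by
  simp_rw [cast_card_inter, Finset.sum_mul_sum, ite_subset_mul_ite_subset]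
  rw [ringAvg_sum]
  simp_rw [ringAvg_sum, ringAvg_subset hK]
  have h : ∀ x ∈ A, ∑ y ∈ B, containProb K P ({x} ∪ {y} : Finset (Fin P)).card
      = B.card * containProb K P 2 := by
    intro x hx
    rw [← nsmul_eq_mul, ← Finset.sum_const]
    refine Finset.sum_congr rfl fun y hy => ?_
    congr 1; exact Finset.card_pair (Finset.disjoint_iff_ne.1 hAB x hx y hy)
  rw [Finset.sum_congr rfl h]
  simp; ring

/-- Expand into triples x, y ∈ A and z ∈ B; by disjointness the only possible coincidence is x = y,
which leaves two keys instead of three. -/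
lemma ringAvg_card_inter_sq_mul (hK : K ≤ P) {A B : Finset (Fin P)} (hAB : Disjoint A B) :
    ringAvg K (fun S => ((A ∩ S).card : ℝ) ^ 2 * (B ∩ S).card)
      = A.card * B.card * containProb K P 2
        + A.card * (A.card - 1) * B.card * containProb K P 3 := by
  have hexp : ∀ S, ((A ∩ S).card : ℝ) ^ 2 * (B ∩ S).card
      = ∑ x ∈ A, ∑ y ∈ A, ∑ z ∈ B, if {x} ∪ {y} ∪ {z} ⊆ S then (1 : ℝ) else 0 := by
    intro S
    rw [sq, cast_card_inter, cast_card_inter, Finset.sum_mul_sum, Finset.sum_mul]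
    refine Finset.sum_congr rfl fun x _ => ?_
    rw [Finset.sum_mul]
    refine Finset.sum_congr rfl fun y _ => ?_
    rw [Finset.mul_sum]
    refine Finset.sum_congr rfl fun z _ => ?_
    rw [ite_subset_mul_ite_subset, ite_subset_mul_ite_subset]
  simp_rw [hexp, ringAvg_sum, ringAvg_subset hK]
  have h : ∀ x ∈ A, ∀ y ∈ A, ∑ z ∈ B, containProb K P ({x} ∪ {y} ∪ {z} : Finset (Fin P)).card
      = if x = y then B.card * containProb K P 2 else B.card * containProb K P 3 := by
    intro x hx y hy
    rw [← mul_ite, ← nsmul_eq_mul, ← Finset.sum_const]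
    refine Finset.sum_congr rfl fun z hz => ?_
    have hxz := Finset.disjoint_iff_ne.1 hAB x hx z hz
    have hyz := Finset.disjoint_iff_ne.1 hAB y hy z hz
    split_ifs with hxy
    · subst hxy
      congr 1
      rw [Finset.union_self]
      exact Finset.card_pair hxz
    · congr 1
      rw [Finset.card_eq_three]
      exact ⟨x, y, z, hxy, hxz, hyz, by ext; simp⟩
  rw [Finset.sum_congr rfl fun x hx => Finset.sum_congr rfl fun y hy => h x hx y hy,
    sum_sum_ite_eq]
  ring

end moments

/-! ### Two-sided bounds for the triangle probability given one ring -/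

/-- The indicator that three key rings intersect pairwise. -/
noncomputable def triangleInd (A B D : Finset (Fin P)) : ℝ :=
  if (A ∩ B).Nonempty ∧ (A ∩ D).Nonempty ∧ (B ∩ D).Nonempty then 1 else 0

/-- The probability that a uniform key ring meets both `A` and `B`. -/
noncomputable def hitBoth (K : ℕ) (A B : Finset (Fin P)) : ℝ :=
  ringAvg K (fun D => if (A ∩ D).Nonempty ∧ (B ∩ D).Nonempty then 1 else 0)

/-- The probability that `A` and two independent uniform key rings intersect pairwise. -/
noncomputable def triangleProbGiven (K : ℕ) (A : Finset (Fin P)) : ℝ :=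
  ringAvg K (fun B => ringAvg K (fun D => triangleInd A B D))

lemma triangleInd_nonneg (A B D : Finset (Fin P)) : 0 ≤ triangleInd A B D := by
  unfold triangleInd; split_ifs <;> simp

lemma triangleInd_eq_zero_or_one (A B D : Finset (Fin P)) :
    triangleInd A B D = 0 ∨ triangleInd A B D = 1 := by
  unfold triangleInd; split_ifs <;> simp

lemma triangleInd_mul_self (A B D : Finset (Fin P)) :
    triangleInd A B D * triangleInd A B D = triangleInd A B D := by
  unfold triangleInd; split_ifs <;> simp

lemma triangleInd_rotate (A B D : Finset (Fin P)) : triangleInd A B D = triangleInd B D A := by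
  unfold triangleInd
  rw [Finset.inter_comm A B, Finset.inter_comm A D]
  congr 1
  exact propext (by tauto)

lemma triangleInd_swap (A B D : Finset (Fin P)) : triangleInd A B D = triangleInd A D B := by
  unfold triangleInd
  rw [Finset.inter_comm B D]
  congr 1
  exact propext (by tauto)

section bounds

variable {K : ℕ} {A B : Finset (Fin P)}

lemma hitBoth_nonneg : 0 ≤ hitBoth K A B := by
  refine ringAvg_nonneg fun S => ?_
  split_ifs <;> simp

lemma ringAvg_triangleInd : ringAvg K (fun D => triangleInd A B D)
    = (if (A ∩ B).Nonempty then 1 else 0) * hitBoth K A B := by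
  rw [hitBoth, ← ringAvg_const_mul]
  congr 1
  ext D
  unfold triangleInd
  split_ifs <;> simp_all

lemma one_le_cast_card {s : Finset (Fin P)} (h : s.Nonempty) : (1 : ℝ) ≤ s.card := by
  exact_mod_cast h.card_pos

/-- Union bound: `D` meets both rings through a key of `A ∩ B`, or through a key of `A \ B` together
with one of `B`. The latter two sets are disjoint, so two distinct keys are needed. -/
lemma hitBoth_le (hK0 : 0 < K) (hK : K ≤ P) (hA : A.card = K) (hB : B.card = K) :
    hitBoth K A B ≤ (A ∩ B).card * ((K : ℝ) / P) + ((K : ℝ) ^ 2 / P) ^ 2 := by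
  have hpt : ∀ D : Finset (Fin P),
      (if (A ∩ D).Nonempty ∧ (B ∩ D).Nonempty then (1 : ℝ) else 0)
        ≤ ((A ∩ B) ∩ D).card + (((A \ B) ∩ D).card : ℝ) * (B ∩ D).card := by
    intro D
    split_ifs with h
    · obtain ⟨⟨x, hx⟩, hBD⟩ := h
      rw [Finset.mem_inter] at hx
      by_cases hxB : x ∈ B
      · have := one_le_cast_card (s := (A ∩ B) ∩ D) ⟨x, by simp [hx, hxB]⟩
        have : (0 : ℝ) ≤ (((A \ B) ∩ D).card : ℝ) * (B ∩ D).card := by positivity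
        linarith
      · have h1 := one_le_cast_card (s := (A \ B) ∩ D) ⟨x, by simp [hx, hxB]⟩
        have h2 := one_le_cast_card hBD
        have h3 : (0 : ℝ) ≤ ((A ∩ B) ∩ D).card := by positivity
        nlinarith
    · positivity
  have hs : ((A \ B).card : ℝ) ≤ K := by
    exact_mod_cast hA ▸ Finset.card_le_card Finset.sdiff_subset
  calc hitBoth K A B ≤ _ := ringAvg_mono fun D _ => hpt D
    _ = (A ∩ B).card * ((K : ℝ) / P) + (A \ B).card * B.card * containProb K P 2 := by
      rw [ringAvg_add, ringAvg_card_inter hK, ringAvg_card_inter_mul hK Finset.sdiff_disjoint]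
    _ ≤ (A ∩ B).card * ((K : ℝ) / P) + K * K * ((K : ℝ) / P) ^ 2 := by
      rw [hB]
      have := containProb_two_le hK0 hK
      have := containProb_nonneg (K := K) (P := P) 2
      gcongr
    _ = _ := by ring

lemma tau_eq : tau K P = K * ((K : ℝ) / P) ^ 2 + ((K : ℝ) ^ 2 / P) ^ 3 := by
  unfold tau; ring

lemma ringAvg_card_inter_sq_le (hK0 : 0 < K) (hK : K ≤ P) (hA : A.card = K) :
    ringAvg K (fun B => ((A ∩ B).card : ℝ) ^ 2) ≤ (K : ℝ) ^ 2 / P + ((K : ℝ) ^ 2 / P) ^ 2 := by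
  have h1 : (1 : ℝ) ≤ K := by exact_mod_cast hK0
  rw [ringAvg_card_inter_sq hK, hA]
  have h2 := containProb_two_le hK0 hK
  have h3 : (K : ℝ) * (K - 1) * containProb K P 2 ≤ K * K * (K / P) ^ 2 := by
    have : (K : ℝ) - 1 ≤ K := by linarith
    have := containProb_nonneg (K := K) (P := P) 2
    gcongr
  calc _ ≤ (K : ℝ) * (K / P) + K * K * (K / P) ^ 2 := by linarith
    _ = _ := by ring

/-- When `A ∩ B` is nonempty its size is at least 1 and absorbs the p² term of `hitBoth_le`. The
bound is then linear in that size, whose mean is p, and p(ρ + p²) = τ. -/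
lemma triangleProbGiven_le_tau (hK0 : 0 < K) (hK : K ≤ P) (hA : A.card = K) :
    triangleProbGiven K A ≤ tau K P := by
  calc triangleProbGiven K A
      ≤ ringAvg K (fun B => ((K : ℝ) / P + ((K : ℝ) ^ 2 / P) ^ 2) * (A ∩ B).card) := by
        refine ringAvg_mono fun B hB => ?_
        rw [ringAvg_triangleInd]
        split_ifs with h
        · have h1 := one_le_cast_card h
          have h2 := hitBoth_le hK0 hK hA hB
          have h3 : (0 : ℝ) ≤ ((K : ℝ) ^ 2 / P) ^ 2 := by positivity
          nlinarith
        · rw [zero_mul]; positivity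
    _ = tau K P := by
        rw [ringAvg_const_mul, ringAvg_card_inter hK, hA, tau_eq]
        ring

/-- Two triangles with a common edge whose endpoints carry `A` and a random ring. -/
lemma ringAvg_hitBoth_sq_le (hK0 : 0 < K) (hK : K ≤ P) (hA : A.card = K)
    (hp : (K : ℝ) ^ 2 / P ≤ 1) :
    (K : ℝ) ^ 2 / P * ringAvg K (fun B => (if (A ∩ B).Nonempty then 1 else 0) * hitBoth K A B ^ 2)
      ≤ 4 * tau K P ^ 2 := by
  set p : ℝ := (K : ℝ) ^ 2 / P with hpdef
  set ρ : ℝ := (K : ℝ) / P with hρ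
  have hpρ : p = K * ρ := by rw [hpdef, hρ]; ring
  have hp0 : 0 ≤ p := by positivity
  have hρ0 : 0 ≤ ρ := by positivity
  have h1 : ringAvg K (fun B => (if (A ∩ B).Nonempty then 1 else 0) * hitBoth K A B ^ 2)
      ≤ 2 * ρ ^ 2 * (p + p ^ 2) + 2 * p ^ 4 * (K * ρ) := by
    -- With I the size of `A ∩ B`, (Iρ + p²)² ≤ 2I²ρ² + 2p⁴ ≤ 2I²ρ² + 2p⁴I for I ≥ 1.
    calc _ ≤ ringAvg K (fun B => 2 * ρ ^ 2 * ((A ∩ B).card : ℝ) ^ 2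
          + 2 * p ^ 4 * (A ∩ B).card) := by
          refine ringAvg_mono fun B hB => ?_
          split_ifs with h
          · have h1 := one_le_cast_card h
            have h2 : hitBoth K A B ≤ (A ∩ B).card * ρ + p ^ 2 := hitBoth_le hK0 hK hA hB
            have h3 : hitBoth K A B ^ 2 ≤ ((A ∩ B).card * ρ + p ^ 2) ^ 2 :=
              pow_le_pow_left₀ hitBoth_nonneg h2 2
            have h4 : p ^ 4 ≤ p ^ 4 * (A ∩ B).card := le_mul_of_one_le_right (by positivity) h1
            nlinarith [sq_nonneg ((A ∩ B).card * ρ - p ^ 2)]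
          · rw [zero_mul]; positivity
      _ ≤ _ := by
          rw [ringAvg_add, ringAvg_const_mul, ringAvg_const_mul, ringAvg_card_inter hK, hA]
          have := ringAvg_card_inter_sq_le hK0 hK hA
          gcongr
  have h2 : tau K P = K * ρ ^ 2 + p ^ 3 := tau_eq
  have h3 : 2 * ρ ^ 2 * (p + p ^ 2) + 2 * p ^ 4 * (K * ρ) ≤ 4 * ρ ^ 2 * p + 2 * p ^ 5 := by
    have : p ^ 2 ≤ p := by nlinarith
    have : ρ ^ 2 * p ^ 2 ≤ ρ ^ 2 * p := by gcongr
    rw [← hpρ]; nlinarith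
  -- The extra factor p completes the squares of the two terms of τ, as ρ²p² = (Kρ²)² and p⁶ =
  -- (p³)².
  calc _ ≤ p * (4 * ρ ^ 2 * p + 2 * p ^ 5) := by gcongr; exact h1.trans h3
    _ = 4 * (K * ρ ^ 2) ^ 2 + 2 * (p ^ 3) ^ 2 := by
      have : p * (4 * ρ ^ 2 * p + 2 * p ^ 5) = 4 * ρ ^ 2 * (p * p) + 2 * (p ^ 3) ^ 2 := by ring
      rw [this]; nth_rewrite 1 2 [hpρ]; ring
    _ ≤ 4 * tau K P ^ 2 := by
      rw [h2]
      have : 0 ≤ (K * ρ ^ 2) * p ^ 3 := by positivity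
      nlinarith [sq_nonneg (p ^ 3)]

/-- With X and Y the numbers of keys of `D` in `A \ B` and in `B`, the polynomial XY(4 - X - Y) is
at most 2 and vanishes if XY = 0, so half its mean is a lower bound. `hI` keeps at least K/2 keys in
`A \ B`, and p ≤ 1/16 makes the third-order terms small. -/
lemma le_hitBoth (hK0 : 2 ≤ K) (hK : K ≤ P) (hA : A.card = K) (hB : B.card = K)
    (hp : (K : ℝ) ^ 2 / P ≤ 1 / 16) (hI : 2 * (A ∩ B).card ≤ K) :
    ((K : ℝ) ^ 2 / P) ^ 2 / 8 ≤ hitBoth K A B := by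
  set p : ℝ := (K : ℝ) ^ 2 / P with hpdef
  set ρ : ℝ := (K : ℝ) / P with hρ
  have hpρ : p = K * ρ := by rw [hpdef, hρ]; ring
  have hp0 : 0 ≤ p := by positivity
  have hρ0 : 0 ≤ ρ := by positivity
  have hK2 : (2 : ℝ) ≤ K := by exact_mod_cast hK0
  have hnat : ∀ X Y : ℕ, (4 * (X * Y) - (X ^ 2 * Y + Y ^ 2 * X) : ℝ) ≤ 2 := by
    intro X Y
    have h0 : (4 * (X * Y) - (X ^ 2 * Y + Y ^ 2 * X) : ℝ) = X * Y * (4 - X - Y) := by ring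
    rw [h0]
    rcases le_or_gt 4 (X + Y) with h | h
    · have h' : (4 : ℝ) ≤ X + Y := by exact_mod_cast h
      have : (0 : ℝ) ≤ X * Y := by positivity
      nlinarith
    · have hX : X < 4 := by omega
      have hY : Y < 4 := by omega
      interval_cases X <;> interval_cases Y <;> first | omega | norm_num
  have hpt : ∀ D : Finset (Fin P),
      4 * ((((A \ B) ∩ D).card : ℝ) * (B ∩ D).card) - ((((A \ B) ∩ D).card : ℝ) ^ 2 * (B ∩ D).card
        + ((B ∩ D).card : ℝ) ^ 2 * ((A \ B) ∩ D).card)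
      ≤ 2 * (if (A ∩ D).Nonempty ∧ (B ∩ D).Nonempty then (1 : ℝ) else 0) := by
    intro D
    split_ifs with h
    · rw [mul_one]; exact hnat _ _
    · rw [not_and_or, Finset.not_nonempty_iff_eq_empty, Finset.not_nonempty_iff_eq_empty] at h
      rcases h with h | h
      · have : (A \ B) ∩ D = ∅ := Finset.subset_empty.1
          (h ▸ Finset.inter_subset_inter_right Finset.sdiff_subset)
        simp [this]
      · simp [h]
  have hd : Disjoint (A \ B) B := Finset.sdiff_disjoint
  have h2 : ρ ^ 2 / 2 ≤ containProb K P 2 := le_containProb_two hK0 hK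
  have h3 : containProb K P 3 ≤ ρ ^ 3 := containProb_three_le (by omega) hK
  have h30 := containProb_nonneg (K := K) (P := P) 3
  have hsd : (A \ B).card + (A ∩ B).card = K := hA ▸ Finset.card_sdiff_add_card_inter A B
  have ha1 : ((A \ B).card : ℝ) ≤ K := by exact_mod_cast (by omega : (A \ B).card ≤ K)
  have ha2 : (K : ℝ) ≤ 2 * (A \ B).card := by exact_mod_cast (by omega : K ≤ 2 * (A \ B).card)
  have hmain := ringAvg_mono (K := K) fun D _ => hpt D
  rw [ringAvg_const_mul, ringAvg_sub, ringAvg_add, ringAvg_const_mul,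
    ringAvg_card_inter_mul hK hd, ringAvg_card_inter_sq_mul hK hd,
    ringAvg_card_inter_sq_mul hK hd.symm, hB] at hmain
  change _ ≤ 2 * hitBoth K A B at hmain
  set a : ℝ := ((A \ B).card : ℝ)
  have hKp : (K : ℝ) * ρ ^ 3 = p * ρ ^ 2 := by rw [hpρ]; ring
  have hab : 0 ≤ a * K := by positivity
  have e1 : (a + K - 2) * containProb K P 3 ≤ 2 * p * ρ ^ 2 := by
    calc _ ≤ 2 * K * ρ ^ 3 := by gcongr; linarith
      _ = _ := by rw [mul_assoc, hKp]; ring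
  have e2 : a * K * ((a + K - 2) * containProb K P 3) ≤ a * K * (ρ ^ 2 / 8) := by
    refine mul_le_mul_of_nonneg_left (e1.trans ?_) hab
    nlinarith [sq_nonneg ρ]
  have e3 : a * K * (ρ ^ 2 / 2) ≤ a * K * containProb K P 2 :=
    mul_le_mul_of_nonneg_left h2 hab
  have e4 : p ^ 2 ≤ 2 * (a * K * ρ ^ 2) := by
    have : (K : ℝ) * (K * ρ ^ 2) ≤ 2 * a * (K * ρ ^ 2) := by gcongr
    rw [hpρ]; nlinarith
  nlinarith

lemma le_triangleProbGiven (hK0 : 0 < K) (hK : K ≤ P) (hA : A.card = K)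
    (hp : (K : ℝ) ^ 2 / P ≤ 1 / 16) : tau K P / 32 ≤ triangleProbGiven K A := by
  have hP0 : (0 : ℝ) < P := by exact_mod_cast hK0.trans_le hK
  have hK1 : (1 : ℝ) ≤ K := by exact_mod_cast hK0
  have hKP : (K : ℝ) ≤ P := by exact_mod_cast hK
  rw [tau_eq]
  have hp' : (K : ℝ) ^ 2 ≤ 1 / 16 * P := (div_le_iff₀ hP0).1 hp
  set p : ℝ := (K : ℝ) ^ 2 / P with hpdef
  set ρ : ℝ := (K : ℝ) / P with hρ
  have hpρ : p = K * ρ := by rw [hpdef, hρ]; ring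
  have hp0 : 0 ≤ p := by positivity
  have hρ0 : 0 ≤ ρ := by positivity
  have hρ1 : ρ ≤ 1 := (div_le_one hP0).2 hKP
  have hI : ringAvg K (fun B => ((A ∩ B).card : ℝ)) = p := by
    rw [ringAvg_card_inter hK, hA, hpρ]
  have hI2 : ringAvg K (fun B => ((A ∩ B).card : ℝ) ^ 2) ≤ p + p ^ 2 :=
    ringAvg_card_inter_sq_le hK0 hK hA
  -- A quadratic minorant, equal to 1 at m = 1, 2 and nonpositive at other naturals, so two moments
  -- suffice for a lower bound.
  have hrec : ∀ m : ℕ, (3 * m - m ^ 2 : ℝ) / 2 ≤ if 0 < m ∧ m ≤ 2 then 1 else 0 := by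
    intro m
    rcases le_or_gt m 2 with h | h
    · interval_cases m <;> norm_num
    · have : (3 : ℝ) ≤ m := by exact_mod_cast h
      rw [if_neg (by omega)]
      nlinarith
  -- The ratio of p³ to Kρ² is K³/P, so this decides which term of τ dominates.
  rcases le_or_gt ((K : ℝ) ^ 3) P with hc | hc
  · have hp3 : p ^ 3 ≤ K * ρ ^ 2 := by
      have : p ^ 3 = (K : ℝ) ^ 3 / P * (K * ρ ^ 2) := by rw [hpdef, hρ]; field_simp
      rw [this]
      exact mul_le_of_le_one_left (by positivity) ((div_le_one hP0).2 hc)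
    -- In this case it is enough to count triangles through a key common to all three rings.
    have hg : ∀ B : Finset (Fin P), B.card = K →
        ρ * (A ∩ B).card - ρ ^ 2 / 2 * ((A ∩ B).card : ℝ) ^ 2
            + ρ ^ 2 / 2 * (A ∩ B).card
          ≤ ringAvg K (fun D => triangleInd A B D) := by
      intro B _
      set C := A ∩ B with hC
      calc _ ≤ ringAvg K (fun D => 3 / 2 * ((C ∩ D).card : ℝ)
            - 1 / 2 * ((C ∩ D).card : ℝ) ^ 2) := by
            rw [ringAvg_sub, ringAvg_const_mul, ringAvg_const_mul, ringAvg_card_inter hK,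
              ringAvg_card_inter_sq hK]
            have h2 := containProb_two_le hK0 hK
            have h3 : (C.card : ℝ) * (C.card - 1) * containProb K P 2
                ≤ (C.card : ℝ) * (C.card - 1) * ρ ^ 2 := by
              refine mul_le_mul_of_nonneg_left h2 ?_
              rcases Nat.eq_zero_or_pos C.card with h | h
              · simp [h]
              · have : (1 : ℝ) ≤ C.card := by exact_mod_cast h
                exact mul_nonneg (by linarith) (by linarith)
            change _ ≤ 3 / 2 * ((C.card : ℝ) * ρ) - _
            nlinarith
        _ ≤ _ := by
            refine ringAvg_mono fun D _ => ?_
            by_cases h : (C ∩ D).Nonempty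
            · obtain ⟨x, hx⟩ := h
              simp only [hC, Finset.mem_inter] at hx
              have ht : triangleInd A B D = 1 := if_pos
                ⟨⟨x, by simp [hx]⟩, ⟨x, by simp [hx]⟩, ⟨x, by simp [hx]⟩⟩
              rw [ht]
              have := hrec (C ∩ D).card
              split_ifs at this <;> linarith
            · rw [Finset.not_nonempty_iff_eq_empty] at h
              simpa [h] using triangleInd_nonneg A B D
    have h1 := ringAvg_mono (K := K) hg
    rw [ringAvg_add, ringAvg_sub, ringAvg_const_mul, ringAvg_const_mul, ringAvg_const_mul, hI]
      at h1
    change _ ≤ triangleProbGiven K A at h1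
    have h2 : ρ ^ 2 / 2 * ringAvg K (fun B => ((A ∩ B).card : ℝ) ^ 2)
        ≤ ρ ^ 2 / 2 * (p + p ^ 2) := by gcongr
    have h3 : ρ * p = K * ρ ^ 2 := by rw [hpρ]; ring
    have h4 : ρ ^ 2 * p ^ 2 ≤ ρ * p := by
      have h5 : ρ * p ≤ 1 := by nlinarith
      have h6 : 0 ≤ ρ * p := by positivity
      nlinarith
    nlinarith
  -- From 16K² ≤ P < K³. With `K ≥ 4`, an intersection of at most 2 keys satisfies the hypothesis
  -- `hI` of `le_hitBoth`.
  · have hK4 : 4 ≤ K := by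
      by_contra h
      have : (K : ℝ) ≤ 3 := by exact_mod_cast (by omega : K ≤ 3)
      nlinarith [sq_nonneg (K : ℝ)]
    have hp3 : K * ρ ^ 2 ≤ p ^ 3 := by
      have : p ^ 3 = (K : ℝ) ^ 3 / P * (K * ρ ^ 2) := by rw [hpdef, hρ]; field_simp
      rw [this]
      exact le_mul_of_one_le_left (by positivity) ((one_le_div hP0).2 hc.le)
    have h1 : p ^ 2 / 8 * ((3 * p - (p + p ^ 2)) / 2) ≤ triangleProbGiven K A := by
      calc _ ≤ p ^ 2 / 8 * ringAvg K (fun B => 3 / 2 * ((A ∩ B).card : ℝ)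
            - 1 / 2 * ((A ∩ B).card : ℝ) ^ 2) := by
            rw [ringAvg_sub, ringAvg_const_mul, ringAvg_const_mul, hI]
            gcongr
            linarith
        _ = ringAvg K (fun B => p ^ 2 / 8 * (3 / 2 * ((A ∩ B).card : ℝ)
            - 1 / 2 * ((A ∩ B).card : ℝ) ^ 2)) := by rw [ringAvg_const_mul]
        _ ≤ _ := by
            refine ringAvg_mono fun B hB => ?_
            rw [ringAvg_triangleInd]
            have h := hrec (A ∩ B).card
            have hh := hitBoth_nonneg (K := K) (A := A) (B := B)
            have hp2 : 0 ≤ p ^ 2 / 8 := by positivity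
            split_ifs at h with hm
            · have := le_hitBoth (by omega) hK hA hB hp (by omega)
              rw [if_pos (Finset.card_pos.1 hm.1)]
              nlinarith
            · refine le_trans ?_ (mul_nonneg (by split_ifs <;> norm_num) hh)
              exact mul_nonpos_of_nonneg_of_nonpos hp2 (by linarith)
    -- Since τ ≤ 2p³ here, this is the source of the constant 32.
    have h2 : p ^ 3 / 16 ≤ p ^ 2 / 8 * ((3 * p - (p + p ^ 2)) / 2) := by
      nlinarith [mul_nonneg (pow_nonneg hp0 3) (by linarith : 0 ≤ 1 - p)]
    linarith

end bounds

/-! ### Correlations of two triangles -/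

/-- The probability that three independent uniform key rings intersect pairwise. -/
noncomputable def triangleProb (K P : ℕ) : ℝ :=
  ringAvg (P := P) K (fun A => triangleProbGiven K A)

section family

variable {ι : Type*} [Fintype ι] [DecidableEq ι] {K : ℕ}

lemma triangleProbGiven_nonneg (A : Finset (Fin P)) : 0 ≤ triangleProbGiven K A :=
  ringAvg_nonneg fun _ => ringAvg_nonneg fun _ => triangleInd_nonneg _ _ _

lemma triangleProb_le_tau (hK0 : 0 < K) (hK : K ≤ P) : triangleProb K P ≤ tau K P := by
  rw [← ringAvg_const (K := K) hK (tau K P)]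
  exact ringAvg_mono fun A hA => triangleProbGiven_le_tau hK0 hK hA

lemma le_triangleProb (hK0 : 0 < K) (hK : K ≤ P) (hp : (K : ℝ) ^ 2 / P ≤ 1 / 16) :
    tau K P / 32 ≤ triangleProb K P := by
  rw [← ringAvg_const (K := K) hK (tau K P / 32)]
  exact ringAvg_mono fun A hA => le_triangleProbGiven hK0 hK hA hp

/-- Resampling the coordinates involved leaves a nested ring average that no longer depends on the
family. The joint moments below are computed in the same way. -/
lemma familyAvg_triangleInd (hK : K ≤ P) {i j k : ι} (hij : i ≠ j) (hik : i ≠ k) (hjk : j ≠ k) :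
    familyAvg K (fun r : ι → Finset (Fin P) => triangleInd (r i) (r j) (r k))
      = triangleProb K P := by
  rw [familyAvg_resample hK k, familyAvg_resample hK j, familyAvg_resample hK i]
  simp only [Function.update_self, Function.update_of_ne hij, Function.update_of_ne hik,
    Function.update_of_ne hjk]
  exact familyAvg_const hK _

lemma familyAvg_triangleInd_mul_disjoint (hK : K ≤ P) {i j k i' j' k' : ι}
    (h : [i, j, k, i', j', k'].Nodup) :
    familyAvg K (fun r : ι → Finset (Fin P) =>
      triangleInd (r i) (r j) (r k) * triangleInd (r i') (r j') (r k'))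
      = triangleProb K P ^ 2 := by
  simp only [List.nodup_cons, List.mem_cons, List.not_mem_nil, or_false, not_or] at h
  obtain ⟨⟨h1, h2, h3, h4, h5⟩, ⟨h6, h7, h8, h9⟩, ⟨h10, h11, h12⟩, ⟨h13, h14⟩, h15, -⟩ := h
  rw [familyAvg_resample hK k', familyAvg_resample hK j', familyAvg_resample hK i',
    familyAvg_resample hK k, familyAvg_resample hK j, familyAvg_resample hK i]
  simp only [Function.update_self, Function.update_of_ne, ne_eq, not_false_eq_true, *]
  simp only [ringAvg_const_mul, ringAvg_mul_const]
  rw [familyAvg_const hK, sq]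
  rfl

/-- Given the ring of the shared node the triangles are independent, and each has conditional
probability at most τ. -/
lemma familyAvg_triangleInd_mul_common_vertex_le (hK0 : 0 < K) (hK : K ≤ P) {i j k j' k' : ι}
    (h : [i, j, k, j', k'].Nodup) :
    familyAvg K (fun r : ι → Finset (Fin P) =>
      triangleInd (r i) (r j) (r k) * triangleInd (r i) (r j') (r k')) ≤ tau K P ^ 2 := by
  simp only [List.nodup_cons, List.mem_cons, List.not_mem_nil, or_false, not_or] at h
  obtain ⟨⟨h1, h2, h3, h4⟩, ⟨h6, h7, h8⟩, ⟨h10, h11⟩, h15, -⟩ := h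
  rw [familyAvg_resample hK k', familyAvg_resample hK j',
    familyAvg_resample hK k, familyAvg_resample hK j, familyAvg_resample hK i]
  simp only [Function.update_self, Function.update_of_ne, ne_eq, not_false_eq_true, *]
  simp only [ringAvg_const_mul, ringAvg_mul_const]
  rw [familyAvg_const hK, ← ringAvg_const (K := K) hK (tau K P ^ 2)]
  refine ringAvg_mono fun A hA => ?_
  rw [sq]
  have h := triangleProbGiven_le_tau hK0 hK hA
  exact mul_le_mul h h (triangleProbGiven_nonneg A) ((triangleProbGiven_nonneg A).trans h)

/-- Given the two shared rings, the remaining rings hit both of them independently, which produces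
the square of `hitBoth`. -/
lemma familyAvg_triangleInd_mul_common_edge_le (hK0 : 0 < K) (hK : K ≤ P)
    (hp : (K : ℝ) ^ 2 / P ≤ 1) {i j k k' : ι} (h : [i, j, k, k'].Nodup) :
    familyAvg K (fun r : ι → Finset (Fin P) =>
      triangleInd (r i) (r j) (r k) * triangleInd (r i) (r j) (r k'))
        ≤ 4 * tau K P ^ 2 / ((K : ℝ) ^ 2 / P) := by
  simp only [List.nodup_cons, List.mem_cons, List.not_mem_nil, or_false, not_or] at h
  obtain ⟨⟨h1, h2, h3⟩, ⟨h6, h7⟩, h10, -⟩ := h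
  rw [familyAvg_resample hK k',
    familyAvg_resample hK k, familyAvg_resample hK j, familyAvg_resample hK i]
  simp only [Function.update_self, Function.update_of_ne, ne_eq, not_false_eq_true, *]
  simp only [ringAvg_const_mul, ringAvg_mul_const, ringAvg_triangleInd]
  rw [familyAvg_const hK, ← ringAvg_const (K := K) hK (4 * tau K P ^ 2 / ((K : ℝ) ^ 2 / P))]
  refine ringAvg_mono fun A hA => ?_
  have hP0 : (0 : ℝ) < P := by exact_mod_cast hK0.trans_le hK
  have hK00 : (0 : ℝ) < K := by exact_mod_cast hK0
  rw [le_div_iff₀ (by positivity), mul_comm]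
  refine (le_of_eq ?_).trans (ringAvg_hitBoth_sq_le hK0 hK hA hp)
  congr 2
  ext B
  split_ifs <;> ring

end family

/-! ### Second moment of the tripartite triangle count -/

section secondMoment

variable {ι : Type*} [Fintype ι] [DecidableEq ι] {K m : ℕ}

/-- As the three classes are disjoint, the shared nodes are read off from i = i', j = j', k = k'.
Adding all the nonnegative error terms, rather than selecting one by cases, lets the sixfold sum be
evaluated termwise. -/
lemma familyAvg_triangleInd_mul_le (hK0 : 0 < K) (hK : K ≤ P) (hp : (K : ℝ) ^ 2 / P ≤ 1)
    {a b c : Fin m → ι} (ha : a.Injective) (hb : b.Injective) (hc : c.Injective)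
    (hab : ∀ i j, a i ≠ b j) (hac : ∀ i j, a i ≠ c j) (hbc : ∀ i j, b i ≠ c j)
    (i j k i' j' k' : Fin m) :
    familyAvg K (fun r : ι → Finset (Fin P) => triangleInd (r (a i)) (r (b j)) (r (c k))
        * triangleInd (r (a i')) (r (b j')) (r (c k')))
      ≤ triangleProb K P ^ 2
        + ((if i = i' then tau K P ^ 2 else 0) + (if j = j' then tau K P ^ 2 else 0)
          + (if k = k' then tau K P ^ 2 else 0))
        + ((if i = i' then if j = j' then 4 * tau K P ^ 2 / ((K : ℝ) ^ 2 / P) else 0 else 0)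
          + (if i = i' then if k = k' then 4 * tau K P ^ 2 / ((K : ℝ) ^ 2 / P) else 0 else 0)
          + (if j = j' then if k = k' then 4 * tau K P ^ 2 / ((K : ℝ) ^ 2 / P) else 0 else 0))
        + (if i = i' then if j = j' then if k = k' then tau K P else 0 else 0 else 0) := by
  have hba : ∀ i j, b i ≠ a j := fun i j => (hab j i).symm
  have hca : ∀ i j, c i ≠ a j := fun i j => (hac j i).symm
  have hcb : ∀ i j, c i ≠ b j := fun i j => (hbc j i).symm
  have hβ : 0 ≤ triangleProb K P ^ 2 := sq_nonneg _
  have hτ2 : 0 ≤ tau K P ^ 2 := sq_nonneg _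
  have hτ : 0 ≤ tau K P := by unfold tau; positivity
  have hE : 0 ≤ 4 * tau K P ^ 2 / ((K : ℝ) ^ 2 / P) := by positivity
  by_cases hi : i = i' <;> by_cases hj : j = j' <;> by_cases hk : k = k' <;>
    simp only [hi, hj, hk, if_true, if_false]
  · simp only [triangleInd_mul_self]
    rw [familyAvg_triangleInd hK (hab _ _) (hac _ _) (hbc _ _)]
    linarith [triangleProb_le_tau hK0 hK]
  · have := familyAvg_triangleInd_mul_common_edge_le hK0 hK hp
      (i := a i') (j := b j') (k := c k) (k' := c k') (by simp [*, hc.eq_iff])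
    linarith
  · have := familyAvg_triangleInd_mul_common_edge_le hK0 hK hp
      (i := a i') (j := c k') (k := b j) (k' := b j') (by simp [*, hb.eq_iff])
    refine (le_of_eq (congrArg _ (funext fun r => ?_))).trans (this.trans (by linarith))
    rw [triangleInd_swap (r (a i')) (r (b j)), triangleInd_swap (r (a i')) (r (b j'))]
  · have := familyAvg_triangleInd_mul_common_vertex_le hK0 hK
      (i := a i') (j := b j) (k := c k) (j' := b j') (k' := c k')
      (by simp [*, hb.eq_iff, hc.eq_iff])
    linarith
  · have := familyAvg_triangleInd_mul_common_edge_le hK0 hK hp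
      (i := b j') (j := c k') (k := a i) (k' := a i') (by simp [*, ha.eq_iff])
    refine (le_of_eq (congrArg _ (funext fun r => ?_))).trans (this.trans (by linarith))
    rw [triangleInd_rotate (r (a i)), triangleInd_rotate (r (a i'))]
  · have := familyAvg_triangleInd_mul_common_vertex_le hK0 hK
      (i := b j') (j := c k) (k := a i) (j' := c k') (k' := a i')
      (by simp [*, ha.eq_iff, hc.eq_iff])
    refine (le_of_eq (congrArg _ (funext fun r => ?_))).trans (this.trans (by linarith))
    rw [triangleInd_rotate (r (a i)), triangleInd_rotate (r (a i'))]
  · have := familyAvg_triangleInd_mul_common_vertex_le hK0 hK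
      (i := c k') (j := a i) (k := b j) (j' := a i') (k' := b j')
      (by simp [*, ha.eq_iff, hb.eq_iff])
    refine (le_of_eq (congrArg _ (funext fun r => ?_))).trans (this.trans (by linarith))
    rw [triangleInd_rotate (r (a i)), triangleInd_rotate (r (b j)),
      triangleInd_rotate (r (a i')), triangleInd_rotate (r (b j'))]
  · rw [familyAvg_triangleInd_mul_disjoint hK
      (by simp [*, ha.eq_iff, hb.eq_iff, hc.eq_iff])]
    linarith

/-- The second moment bound for the number of triangles with one vertex in each of three
disjoint classes of `m` nodes. -/
lemma familyAvg_indicator_mul_sq_le (hK0 : 0 < K) (hK : K ≤ P) (hp : (K : ℝ) ^ 2 / P ≤ 1)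
    {a b c : Fin m → ι} (ha : a.Injective) (hb : b.Injective) (hc : c.Injective)
    (hab : ∀ i j, a i ≠ b j) (hac : ∀ i j, a i ≠ c j) (hbc : ∀ i j, b i ≠ c j)
    {S : Set (ι → Finset (Fin P))}
    (hS : ∀ r ∈ S, ∀ i j k, triangleInd (r (a i)) (r (b j)) (r (c k)) = 0) :
    familyAvg K (S.indicator 1) * ((m : ℝ) ^ 3 * triangleProb K P) ^ 2
      ≤ 3 * (m : ℝ) ^ 5 * tau K P ^ 2
        + 3 * (m : ℝ) ^ 4 * (4 * tau K P ^ 2 / ((K : ℝ) ^ 2 / P)) + (m : ℝ) ^ 3 * tau K P := by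
  set β := triangleProb K P
  set N : (ι → Finset (Fin P)) → ℝ := fun r =>
    ∑ i, ∑ j, ∑ k, triangleInd (r (a i)) (r (b j)) (r (c k)) with hN
  set M : ℝ := (m : ℝ) ^ 3 * β with hM
  have h1 : familyAvg K N = M := by
    simp only [hN, familyAvg_sum, familyAvg_triangleInd hK (hab _ _) (hac _ _) (hbc _ _)]
    simp [hM, β]; ring
  have hNN : ∀ r, N r * N r = ∑ i, ∑ j, ∑ k, ∑ i', ∑ j', ∑ k',
      triangleInd (r (a i)) (r (b j)) (r (c k))
        * triangleInd (r (a i')) (r (b j')) (r (c k')) := by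
    intro r
    simp only [hN, Finset.sum_mul]
    simp only [Finset.mul_sum]
  have h2 : familyAvg K (fun r => N r * N r) ≤ M ^ 2 + (3 * (m : ℝ) ^ 5 * tau K P ^ 2
        + 3 * (m : ℝ) ^ 4 * (4 * tau K P ^ 2 / ((K : ℝ) ^ 2 / P)) + (m : ℝ) ^ 3 * tau K P) := by
    simp only [hNN, familyAvg_sum]
    calc _ ≤ _ := Finset.sum_le_sum fun i _ => Finset.sum_le_sum fun j _ =>
          Finset.sum_le_sum fun k _ => Finset.sum_le_sum fun i' _ => Finset.sum_le_sum fun j' _ =>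
          Finset.sum_le_sum fun k' _ =>
            familyAvg_triangleInd_mul_le hK0 hK hp ha hb hc hab hac hbc i j k i' j' k'
      _ = _ := by
        simp only [Finset.sum_add_distrib, Finset.sum_const, Finset.card_univ, Fintype.card_fin,
          nsmul_eq_mul, Finset.sum_ite_eq, Finset.mem_univ, if_true, Finset.sum_ite_irrel,
          mul_ite, mul_zero, hM]
        ring
  -- Chebyshev: `N` vanishes on `S`, so M² times the indicator of `S` is at most (N - M)².
  have h3 : familyAvg K (S.indicator 1) * M ^ 2
      ≤ familyAvg K (fun r => N r * N r) - M ^ 2 := by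
    calc _ = familyAvg K (fun r => M ^ 2 * S.indicator 1 r) := by
          rw [familyAvg_const_mul, mul_comm]
      _ ≤ familyAvg K (fun r => N r * N r - 2 * M * N r + M ^ 2) := by
          refine familyAvg_mono fun r => ?_
          by_cases hr : r ∈ S
          · have : N r = 0 := by simp [hN, hS r hr]
            simp [hr, this]
          · simp only [Set.indicator_of_notMem hr]
            nlinarith [sq_nonneg (N r - M)]
      _ = _ := by
          rw [familyAvg_add, familyAvg_sub, familyAvg_const_mul, h1, familyAvg_const hK]
          ring
  linarith

end secondMoment

end basics

lemma numTriangles_pos_iff {n P : ℕ} (r : Fin n → Finset (Fin P)) :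
    0 < numTriangles r ↔
      ∃ i j k, i ≠ j ∧ i ≠ k ∧ j ≠ k ∧ triangleInd (r i) (r j) (r k) = 1 := by
  have h1 : ∀ i j k, triangleInd (r i) (r j) (r k) = 1 ↔
      (r i ∩ r j).Nonempty ∧ (r i ∩ r k).Nonempty ∧ (r j ∩ r k).Nonempty := by
    intro i j k
    unfold triangleInd
    split_ifs with h <;> simp [h]
  rw [numTriangles, Finset.card_pos]
  constructor
  · rintro ⟨s, hs⟩
    rw [SimpleGraph.mem_cliqueFinset_iff, SimpleGraph.is3Clique_iff] at hs
    obtain ⟨i, j, k, hij, hik, hjk, -⟩ := hs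
    exact ⟨i, j, k, hij.1, hik.1, hjk.1, (h1 _ _ _).2 ⟨hij.2, hik.2, hjk.2⟩⟩
  · rintro ⟨i, j, k, hij, hik, hjk, h⟩
    obtain ⟨e1, e2, e3⟩ := (h1 _ _ _).1 h
    exact ⟨{i, j, k}, SimpleGraph.mem_cliqueFinset_iff.2
      (SimpleGraph.is3Clique_triple_iff.2 ⟨⟨hij, e1⟩, ⟨hik, e2⟩, ⟨hjk, e3⟩⟩)⟩

/-! ### Bounds for the triangle event -/

section event

variable {n K P : ℕ} {Ω : Type*} [MeasurableSpace Ω] {μ : Measure Ω} [IsProbabilityMeasure μ]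
  {R : Fin n → Ω → Finset (Fin P)}

lemma tau_nonneg : 0 ≤ tau K P := by unfold tau; positivity

lemma tau_pos (hK0 : 0 < K) (hK : K ≤ P) : 0 < tau K P := by
  have hP0 : (0 : ℝ) < P := by exact_mod_cast hK0.trans_le hK
  have hK00 : (0 : ℝ) < K := by exact_mod_cast hK0
  unfold tau; positivity

/-- Union bound over ordered triples; counting each triangle six times is harmless. -/
lemma IsKeyRings.real_triangleEvent_le (hR : IsKeyRings μ K R) (hK0 : 0 < K) (hK : K ≤ P) :
    μ.real (triangleEvent R) ≤ (n : ℝ) ^ 3 * tau K P := by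
  change μ.real {ω | (fun i => R i ω) ∈ {r | 0 < numTriangles r}} ≤ _
  rw [hR.real_eq_familyAvg hK]
  calc familyAvg K ({r : Fin n → Finset (Fin P) | 0 < numTriangles r}.indicator 1)
      ≤ familyAvg K (fun r => ∑ i, ∑ j, ∑ k,
          (if i ≠ j ∧ i ≠ k ∧ j ≠ k then (1 : ℝ) else 0) * triangleInd (r i) (r j) (r k)) := by
        refine familyAvg_mono fun r => ?_
        have hnn : ∀ i j k, 0 ≤ (if i ≠ j ∧ i ≠ k ∧ j ≠ k then (1 : ℝ) else 0)
            * triangleInd (r i) (r j) (r k) := fun i j k =>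
          mul_nonneg (by split_ifs <;> norm_num) (triangleInd_nonneg _ _ _)
        by_cases hr : 0 < numTriangles r
        · obtain ⟨i, j, k, hij, hik, hjk, h⟩ := (numTriangles_pos_iff r).1 hr
          have e1 := Finset.single_le_sum (s := Finset.univ) (fun k _ => hnn i j k)
            (Finset.mem_univ k)
          have e2 := Finset.single_le_sum (s := Finset.univ)
            (fun j _ => Finset.sum_nonneg (s := Finset.univ) fun k _ => hnn i j k)
            (Finset.mem_univ j)
          have e3 := Finset.single_le_sum (s := Finset.univ)
            (fun i _ => Finset.sum_nonneg (s := Finset.univ) fun j _ =>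
              Finset.sum_nonneg (s := Finset.univ) fun k _ => hnn i j k) (Finset.mem_univ i)
          rw [if_pos ⟨hij, hik, hjk⟩, h] at e1
          rw [Set.indicator_of_mem (by exact hr)]
          simp only [Pi.one_apply]
          linarith
        · rw [Set.indicator_of_notMem (by exact hr)]
          exact Finset.sum_nonneg fun i _ => Finset.sum_nonneg fun j _ =>
            Finset.sum_nonneg fun k _ => hnn i j k
    _ ≤ ∑ i : Fin n, ∑ j : Fin n, ∑ k : Fin n, tau K P := by
        rw [familyAvg_sum]
        simp_rw [familyAvg_sum]
        refine Finset.sum_le_sum fun i _ => Finset.sum_le_sum fun j _ =>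
          Finset.sum_le_sum fun k _ => ?_
        rw [familyAvg_const_mul]
        split_ifs with h
        · rw [familyAvg_triangleInd hK h.1 h.2.1 h.2.2, one_mul]
          exact triangleProb_le_tau hK0 hK
        · rw [zero_mul]; exact tau_nonneg
    _ = _ := by simp; ring

lemma IsKeyRings.one_sub_real_triangleEvent_le (hR : IsKeyRings μ K R) (hn : 3 ≤ n)
    (hK0 : 0 < K) (hK : K ≤ P) (hp : (K : ℝ) ^ 2 / P ≤ 1 / 16) :
    1 - μ.real (triangleEvent R) ≤ 1024 * (27 * (n : ℝ)⁻¹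
      + 972 * ((n : ℝ) ^ 2 * ((K : ℝ) ^ 2 / P))⁻¹ + 729 * ((n : ℝ) ^ 3 * tau K P)⁻¹) := by
  have hP0 : (0 : ℝ) < P := by exact_mod_cast hK0.trans_le hK
  have hK00 : (0 : ℝ) < K := by exact_mod_cast hK0
  have hn0 : (0 : ℝ) < n := by exact_mod_cast (by omega : 0 < n)
  set S : Set (Fin n → Finset (Fin P)) := {r | ¬ 0 < numTriangles r} with hSdef
  have h1 : 1 - μ.real (triangleEvent R) = familyAvg K (S.indicator 1) := by
    change 1 - μ.real {ω | (fun i => R i ω) ∈ {r | 0 < numTriangles r}} = _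
    rw [hR.real_eq_familyAvg hK]
    nth_rewrite 1 [← familyAvg_const (ι := Fin n) hK (1 : ℝ)]
    rw [← familyAvg_sub]
    congr 1
    ext r
    simp only [hSdef, Set.indicator_apply, Set.mem_ofPred_eq, Pi.one_apply]
    split_ifs <;> norm_num
  -- The classes are three consecutive blocks of `m` nodes; at most two nodes are left out.
  set m := n / 3 with hm
  have hm1 : 1 ≤ m := by omega
  have hm3 : 3 * m ≤ n := by omega
  have h2 := familyAvg_indicator_mul_sq_le (ι := Fin n) (m := m) hK0 hK (by linarith)
    (a := fun i => ⟨i, by omega⟩) (b := fun i => ⟨m + i, by omega⟩)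
    (c := fun i => ⟨2 * m + i, by omega⟩)
    (fun i j h => by simpa [Fin.ext_iff] using h) (fun i j h => by simpa [Fin.ext_iff] using h)
    (fun i j h => by simpa [Fin.ext_iff] using h)
    (fun i j h => by have := Fin.ext_iff.1 h; dsimp at this; omega)
    (fun i j h => by have := Fin.ext_iff.1 h; dsimp at this; omega)
    (fun i j h => by have := Fin.ext_iff.1 h; dsimp at this; omega) (S := S)
    (by
      intro r hr i j k
      by_contra h
      have hr' : ¬ 0 < numTriangles r := hr
      refine hr' ((numTriangles_pos_iff r).2
        ⟨_, _, _, ?_, ?_, ?_, (triangleInd_eq_zero_or_one _ _ _).resolve_left h⟩)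
      all_goals
        intro h
        have := Fin.ext_iff.1 h
        dsimp at this
        omega)
  set f := familyAvg K (S.indicator 1)
  have hf : 0 ≤ f := by rw [← h1]; exact sub_nonneg.2 measureReal_le_one
  rw [h1]
  have hτ := tau_pos hK0 hK
  have hβ := le_triangleProb hK0 hK hp
  set p : ℝ := (K : ℝ) ^ 2 / P
  have hp0 : 0 < p := by positivity
  set t := tau K P
  have hm0 : (0 : ℝ) < m := by exact_mod_cast hm1
  -- A crude bound, giving the constants 27 = 3 · 9, 972 = 12 · 9² and 729 = 9³.
  have hmn : (n : ℝ) ≤ 9 * m := by exact_mod_cast (by omega : n ≤ 9 * m)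
  have h3 : f * ((m : ℝ) ^ 3 * (t / 32)) ^ 2
      ≤ 3 * (m : ℝ) ^ 5 * t ^ 2 + 3 * (m : ℝ) ^ 4 * (4 * t ^ 2 / p) + (m : ℝ) ^ 3 * t :=
    le_trans (by gcongr) h2
  -- The factor 1024 = 32² comes from replacing β by τ/32 in the squared mean.
  have h4 : f ≤ 1024 * (3 * (m : ℝ)⁻¹ + 12 * ((m : ℝ) ^ 2 * p)⁻¹ + ((m : ℝ) ^ 3 * t)⁻¹) := by
    rw [← le_div_iff₀ (by positivity)] at h3
    refine h3.trans (le_of_eq ?_)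
    field_simp
    ring
  refine h4.trans ?_
  have i1 : (m : ℝ)⁻¹ ≤ 9 * (n : ℝ)⁻¹ := by
    rw [inv_le_iff_one_le_mul₀ hm0, mul_assoc, mul_comm, mul_assoc, inv_mul_eq_div,
      one_le_div hn0]
    nlinarith
  have i2 : ((m : ℝ) ^ 2 * p)⁻¹ ≤ 81 * ((n : ℝ) ^ 2 * p)⁻¹ := by
    rw [mul_inv, mul_inv, ← inv_pow, ← inv_pow, ← mul_assoc]
    gcongr
    calc ((m : ℝ)⁻¹) ^ 2 ≤ (9 * (n : ℝ)⁻¹) ^ 2 := by gcongr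
      _ = _ := by ring
  have i3 : ((m : ℝ) ^ 3 * t)⁻¹ ≤ 729 * ((n : ℝ) ^ 3 * t)⁻¹ := by
    rw [mul_inv, mul_inv, ← inv_pow, ← inv_pow, ← mul_assoc]
    gcongr
    calc ((m : ℝ)⁻¹) ^ 3 ≤ (9 * (n : ℝ)⁻¹) ^ 3 := by gcongr
      _ = _ := by ring
  linarith

end event

/-! ### Consequences of q → 1 and n³τ → ∞ -/

section asymptotics

variable {K P : ℕ}

/-- For 2K ≤ P, q is a product of `K` factors (P - K - j)/(P - j), each at most 1 - K/P ≤ exp(-K/P).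
-/
lemma q_le_exp (hK0 : 0 < K) (hK : K ≤ P) : q K P ≤ Real.exp (-((K : ℝ) ^ 2 / P)) := by
  have hP0 : (0 : ℝ) < P := by exact_mod_cast hK0.trans_le hK
  have hKP : (K : ℝ) ≤ P := by exact_mod_cast hK
  unfold q
  split_ifs with h
  · positivity
  have hdesc : ∀ j ≤ K, ((P - K).descFactorial j : ℝ)
      ≤ (1 - (K : ℝ) / P) ^ j * P.descFactorial j := by
    intro j
    induction j with
    | zero => simp
    | succ j ih =>
      intro hj
      have hj' : (j : ℝ) ≤ K := by exact_mod_cast (by omega : j ≤ K)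
      rw [Nat.descFactorial_succ, Nat.descFactorial_succ]
      push_cast [Nat.cast_sub (show j ≤ P - K by omega), Nat.cast_sub hK,
        Nat.cast_sub (show j ≤ P by omega)]
      have h1 : (P - K - j : ℝ) ≤ (1 - (K : ℝ) / P) * (P - j) := by
        have : (1 - (K : ℝ) / P) * (P - j) = P - K - j + K / P * j := by field_simp; ring
        rw [this]
        have : 0 ≤ (K : ℝ) / P * j := by positivity
        linarith
      have h2 : 0 ≤ 1 - (K : ℝ) / P := sub_nonneg.2 ((div_le_one hP0).2 hKP)
      have h3 : 0 ≤ (P - K - j : ℝ) := by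
        have : ((K + j : ℕ) : ℝ) ≤ P := by exact_mod_cast (by omega : K + j ≤ P)
        push_cast at this
        linarith
      calc (P - K - j : ℝ) * (P - K).descFactorial j
          ≤ ((1 - (K : ℝ) / P) * (P - j)) * ((1 - (K : ℝ) / P) ^ j * P.descFactorial j) :=
            mul_le_mul h1 (ih (by omega)) (by positivity) (h3.trans h1)
        _ = _ := by ring
  have hfac : (K.factorial : ℝ) ≠ 0 := by exact_mod_cast K.factorial_ne_zero
  have hd0 : (0 : ℝ) < P.descFactorial K := by
    exact_mod_cast Nat.descFactorial_pos.2 hK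
  have h1 : ((P - K).choose K : ℝ) / (P.choose K : ℝ)
      = (P - K).descFactorial K / P.descFactorial K := by
    rw [Nat.descFactorial_eq_factorial_mul_choose, Nat.descFactorial_eq_factorial_mul_choose]
    push_cast
    rw [mul_div_mul_left _ _ hfac]
  rw [h1]
  calc _ ≤ (1 - (K : ℝ) / P) ^ K := (div_le_iff₀ hd0).2 (hdesc K le_rfl)
    _ ≤ Real.exp (-((K : ℝ) / P)) ^ K := by
      refine pow_le_pow_left₀ (sub_nonneg.2 ((div_le_one hP0).2 hKP)) ?_ K
      linarith [Real.add_one_le_exp (-((K : ℝ) / P))]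
    _ = _ := by
      rw [← Real.exp_nat_mul]
      congr 1
      ring

/-- Both terms of τ have square at most p³: (Kρ²)² = p³ρ/K with ρ ≤ 1 ≤ K, and p⁶ ≤ p³. -/
lemma tau_sq_le (hK0 : 0 < K) (hK : K ≤ P) (hp : (K : ℝ) ^ 2 / P ≤ 1) :
    tau K P ^ 2 ≤ 4 * ((K : ℝ) ^ 2 / P) ^ 3 := by
  have hP0 : (0 : ℝ) < P := by exact_mod_cast hK0.trans_le hK
  have hK1 : (1 : ℝ) ≤ K := by exact_mod_cast hK0
  have hKP : (K : ℝ) ≤ P := by exact_mod_cast hK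
  rw [tau_eq]
  set p : ℝ := (K : ℝ) ^ 2 / P with hpdef
  set ρ : ℝ := (K : ℝ) / P with hρ
  have hpρ : p = K * ρ := by rw [hpdef, hρ]; ring
  have hp0 : 0 ≤ p := by positivity
  have hρ0 : 0 ≤ ρ := by positivity
  have hρ1 : ρ ≤ 1 := (div_le_one hP0).2 hKP
  have h1 : (K * ρ ^ 2) ^ 2 ≤ p ^ 3 := by
    have : p ^ 3 = K ^ 2 * ρ ^ 3 * K := by rw [hpρ]; ring
    have h2 : (K * ρ ^ 2) ^ 2 = K ^ 2 * ρ ^ 3 * ρ := by ring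
    rw [this, h2]
    exact mul_le_mul_of_nonneg_left (hρ1.trans hK1) (by positivity)
  have h2 : (p ^ 3) ^ 2 ≤ p ^ 3 := by
    have : p ^ 3 ≤ 1 := pow_le_one₀ hp0 hp
    have : 0 ≤ p ^ 3 := by positivity
    nlinarith
  nlinarith [sq_nonneg (K * ρ ^ 2 - p ^ 3)]

end asymptotics

section sequences

variable {K P : ℕ → ℕ}

lemma IsScaling.tendsto_sq_div (hKP : IsScaling K P)
    (hq : Tendsto (fun n => q (K n) (P n)) atTop (𝓝 1)) :
    Tendsto (fun n => (K n : ℝ) ^ 2 / P n) atTop (𝓝 0) := by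
  have hlog : Tendsto (fun n => -Real.log (q (K n) (P n))) atTop (𝓝 0) := by
    simpa using (hq.log one_ne_zero).neg
  refine tendsto_of_tendsto_of_tendsto_of_le_of_le' tendsto_const_nhds hlog
    (Eventually.of_forall fun n => by positivity) ?_
  filter_upwards [eventually_ge_atTop 2, hq.eventually (lt_mem_nhds one_pos)] with n hn hqn
  have := Real.log_le_log hqn (q_le_exp (hKP.pos n hn) (hKP.le n hn))
  rw [Real.log_exp] at this
  linarith

lemma IsScaling.tendsto_sq_mul_sq_div (hKP : IsScaling K P)
    (hp : Tendsto (fun n => (K n : ℝ) ^ 2 / P n) atTop (𝓝 0))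
    (hτ : Tendsto (fun n : ℕ => (n : ℝ) ^ 3 * tau (K n) (P n)) atTop atTop) :
    Tendsto (fun n : ℕ => (n : ℝ) ^ 2 * ((K n : ℝ) ^ 2 / P n)) atTop atTop := by
  rw [tendsto_atTop]
  intro b
  -- With c = max(b, 1), n²p < b would give (n³τ)² ≤ 4c³ ≤ 4c⁴ < (2c² + 1)², contradicting the
  -- threshold chosen here.
  filter_upwards [eventually_ge_atTop 2, hp.eventually (gt_mem_nhds one_pos),
    hτ.eventually_ge_atTop (2 * (max b 1) ^ 2 + 1)] with n hn hpn hτn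
  by_contra! hlt
  have h1 := tau_sq_le (hKP.pos n hn) (hKP.le n hn) hpn.le
  set c := max b 1
  have hc1 : 1 ≤ c := le_max_right _ _
  have hlt' : (n : ℝ) ^ 2 * ((K n : ℝ) ^ 2 / P n) ≤ c := hlt.le.trans (le_max_left _ _)
  have h2 : ((n : ℝ) ^ 3 * tau (K n) (P n)) ^ 2 ≤ 4 * c ^ 3 := by
    calc _ = (n : ℝ) ^ 6 * tau (K n) (P n) ^ 2 := by ring
      _ ≤ (n : ℝ) ^ 6 * (4 * ((K n : ℝ) ^ 2 / P n) ^ 3) := by gcongr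
      _ = 4 * ((n : ℝ) ^ 2 * ((K n : ℝ) ^ 2 / P n)) ^ 3 := by ring
      _ ≤ 4 * c ^ 3 := by gcongr
  have h3 : (2 * c ^ 2 + 1) ^ 2 ≤ ((n : ℝ) ^ 3 * tau (K n) (P n)) ^ 2 := by gcongr
  have h4 : c ^ 3 ≤ c ^ 4 := pow_le_pow_right₀ hc1 (by norm_num)
  nlinarith [sq_nonneg c]

end sequences

end RandomKeyGraph

/-! ### The zero-one law -/

theorem theorem3 (K P : ℕ → ℕ) (hKP : RandomKeyGraph.IsScaling K P)
    {Ω : ℕ → Type*} [∀ n, MeasurableSpace (Ω n)]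
    (μ : ∀ n, Measure (Ω n)) [∀ n, IsProbabilityMeasure (μ n)]
    (R : ∀ n, Fin n → Ω n → Finset (Fin (P n)))
    (hR : ∀ n, RandomKeyGraph.IsKeyRings (μ n) (K n) (R n))
    (hq : Tendsto (fun n => RandomKeyGraph.q (K n) (P n)) atTop (𝓝 1)) :
    (Tendsto (fun n : ℕ => (n : ℝ) ^ 3 * RandomKeyGraph.tau (K n) (P n)) atTop (𝓝 0) →
      Tendsto (fun n => (μ n).real (RandomKeyGraph.triangleEvent (R n))) atTop (𝓝 0)) ∧
    (Tendsto (fun n : ℕ => (n : ℝ) ^ 3 * RandomKeyGraph.tau (K n) (P n)) atTop atTop →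
      Tendsto (fun n => (μ n).real (RandomKeyGraph.triangleEvent (R n))) atTop (𝓝 1)) := by
  constructor
  · intro hτ
    refine tendsto_of_tendsto_of_tendsto_of_le_of_le' tendsto_const_nhds hτ
      (Eventually.of_forall fun n => measureReal_nonneg) ?_
    filter_upwards [eventually_ge_atTop 2] with n hn
    exact (hR n).real_triangleEvent_le (hKP.pos n hn) (hKP.le n hn)
  · intro hτ
    have hp := hKP.tendsto_sq_div hq
    have hnp := hKP.tendsto_sq_mul_sq_div hp hτ
    have hbound := (((tendsto_natCast_atTop_atTop (R := ℝ)).inv_tendsto_atTop.const_mul 27).add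
      (hnp.inv_tendsto_atTop.const_mul 972)).add (hτ.inv_tendsto_atTop.const_mul 729)
    have hlower := (hbound.const_mul 1024).const_sub 1
    simp only [mul_zero, add_zero, sub_zero] at hlower
    refine tendsto_of_tendsto_of_tendsto_of_le_of_le' hlower tendsto_const_nhds ?_
      (Eventually.of_forall fun n => measureReal_le_one)
    filter_upwards [eventually_ge_atTop 3,
      hp.eventually (gt_mem_nhds (by norm_num : (0 : ℝ) < 1 / 16))] with n hn hpn
    have := (hR n).one_sub_real_triangleEvent_le hn (hKP.pos n (by omega)) (hKP.le n (by omega))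
      hpn.le
    simp only [Pi.inv_apply]
    linarith
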